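/- Let $(X,d)$ be a nonempty compact metric space, let $P(X)$ be the set of Borel probability measures on $X$, and for finite Borel measures $\mu,\nu$ on $X$ put $$d_{KR}(\mu,\nu)=\sup\Big\{\Big|\int_X f\,d\mu-\int_X f\,d\nu\Big| : f\in C_c(X),\ |f(x)-f(y)|\le d(x,y)\ \text{for all } x,y\in X\Big\}.$$ Let $(u_i)_{i\in I}$ be a finite or countably infinite family of maps $u_i:X\to X$ with $d(u_i(x),u_i(y))\le s_i\,d(x,y)$ for all $x,y\in X$, where $0\le s_i\le s<1$, and let $\alpha_i\ge 0$ with $\sum_{i\in I}\alpha_i\le 1$. For a Borel measure $\nu$ on $X$ put $M(\nu)=\sum_{i\in I}\alpha_i\,\nu\circ u_i^{-1}$. (1) For all $\mu,\nu\in P(X)$, $d_{KR}(\mu,\nu)<\infty$ and $d_{KR}(M(\mu),M(\nu))\le s\,d_{KR}(\mu,\nu)$. (2) If $\sum_{i\in I}\alpha_i=1$, then $M$ maps $P(X)$ into $P(X)$, and there is a unique $m_0\in P(X)$ with $M(m_0)=m_0$. (3) If $I$ is finite, all $\alpha_i>0$, and $m_0\in P(X)$ satisfies $M(m_0)=m_0$,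 then the support of $m_0$ (the complement of the largest open set of $m_0$-measure zero) is the attractor of the iterated function system $\{X,(u_i)_{i\in I}\}$, that is, the unique nonempty compact set $A\subseteq X$ with $\bigcup_{i\in I}u_i(A)=A$. -/

import Mathlib

open MeasureTheory
open scoped ENNReal NNReal

/-- The Kantorovich–Rubinstein distance: the supremum of `|∫ f dμ - ∫ f dν|` over all compactly
supported `f : X → ℝ` with `|f x - f y| ≤ d(x, y)`. It takes values in `[0, ∞]`. -/
noncomputable def krDist {X : Type*} [MetricSpace X] [MeasurableSpace X] (μ ν : Measure X) :
    ℝ≥0∞ :=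
  ⨆ (f : X → ℝ) (_ : LipschitzWith 1 f) (_ : HasCompactSupport f),
    ENNReal.ofReal |∫ x, f x ∂μ - ∫ x, f x ∂ν|

/-- The Markov operator `M(ν) = ∑ i, α i • (ν ∘ (u i)⁻¹)`. -/
noncomputable def markovOp {X ι : Type*} [MeasurableSpace X] (u : ι → X → X) (α : ι → ℝ≥0)
    (ν : Measure X) : Measure X :=
  Measure.sum fun i => α i • ν.map (u i)

/-- `A` is the attractor of the iterated function system `u`: the unique fixed point of
`W(B) = ⋃ i, u i '' B` among the nonempty compact subsets of `X`. -/
structure IsIFSAttractor {X ι : Type*} [TopologicalSpace X] (u : ι → X → X) (A : Set X) :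
    Prop where
  nonempty : A.Nonempty
  isCompact : IsCompact A
  fixed : ⋃ i, u i '' A = A
  unique : ∀ B : Set X, B.Nonempty → IsCompact B → ⋃ i, u i '' B = B → B = A

open Metric Set Filter Topology

section KantorovichRubinstein

variable {X : Type*} [MetricSpace X] [CompactSpace X] [MeasurableSpace X]

/-! Composing a 1-Lipschitz test function with `u i` gives an `s`-Lipschitz one, so `M` contracts
`krDist` by `s`. As `krDist` is finite and separates probability measures, fixed points are unique.
Existence avoids completeness: weak compactness of `ProbabilityMeasure X` gives a minimizer of the
displacement `krDist (M μ) μ`, and contraction forces the minimum to be 0. Invariance of the measure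
makes its support a fixed set of the IFS, and a farthest-point argument shows that there is only
one. -/

lemma ofReal_abs_integral_sub_le_krDist {f : X → ℝ} (hf : LipschitzWith 1 f) (μ ν : Measure X) :
    ENNReal.ofReal |∫ x, f x ∂μ - ∫ x, f x ∂ν| ≤ krDist μ ν :=
  le_iSup₂_of_le f hf <| le_iSup_of_le (HasCompactSupport.of_compactSpace f) le_rfl

/-- The difference of the integrals of a `K`-Lipschitz function against two probability measures
is at most `K` times their Kantorovich–Rubinstein distance. -/
lemma LipschitzWith.ofReal_abs_integral_sub_le {K : ℝ≥0} {f : X → ℝ} (hf : LipschitzWith K f)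
    (μ ν : Measure X) [IsProbabilityMeasure μ] [IsProbabilityMeasure ν] :
    ENNReal.ofReal |∫ x, f x ∂μ - ∫ x, f x ∂ν| ≤ K * krDist μ ν := by
  rcases eq_or_ne K 0 with rfl | hK
  -- Rescaling by `K⁻¹` is unavailable here, but `f` is constant and both masses are 1.
  · obtain ⟨x₀⟩ : Nonempty X := μ.nonempty_of_neZero
    have hconst : ∀ x, f x = f x₀ := fun x => by
      simpa using hf x x₀
    simp [hconst]
  · have hg : LipschitzWith 1 fun x => (K : ℝ)⁻¹ * f x := by
      refine LipschitzWith.of_dist_le_mul fun x y => ?_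
      have hK' : (0 : ℝ) < K := by positivity
      have h := hf.dist_le_mul x y
      rw [Real.dist_eq] at h ⊢
      rw [← mul_sub, abs_mul, abs_inv, NNReal.abs_eq, inv_mul_le_iff₀ hK']
      simpa using h
    calc ENNReal.ofReal |∫ x, f x ∂μ - ∫ x, f x ∂ν|
        = K * ENNReal.ofReal
            |∫ x, (K : ℝ)⁻¹ * f x ∂μ - ∫ x, (K : ℝ)⁻¹ * f x ∂ν| := by
          rw [integral_const_mul, integral_const_mul, ← mul_sub, abs_mul, abs_inv,
            NNReal.abs_eq, ← ENNReal.ofReal_coe_nnreal, ← ENNReal.ofReal_mul (by positivity),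
            mul_inv_cancel_left₀ (by positivity)]
      _ ≤ K * krDist μ ν := by gcongr; exact ofReal_abs_integral_sub_le_krDist hg μ ν

variable [BorelSpace X]

lemma Continuous.integrable_of_compactSpace {f : X → ℝ} (hf : Continuous f) (μ : Measure X)
    [IsFiniteMeasure μ] : Integrable f μ :=
  hf.integrable_of_hasCompactSupport (HasCompactSupport.of_compactSpace f)

lemma krDist_ne_top (μ ν : Measure X) [IsProbabilityMeasure μ] [IsProbabilityMeasure ν] :
    krDist μ ν ≠ ∞ := by
  obtain ⟨x₀⟩ : Nonempty X := μ.nonempty_of_neZero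
  have key : ∀ f : X → ℝ, LipschitzWith 1 f → ∀ (ρ : Measure X) [IsProbabilityMeasure ρ],
      |∫ x, f x ∂ρ - f x₀| ≤ diam (univ : Set X) := fun f hf ρ _ => by
    have hfi := hf.continuous.integrable_of_compactSpace ρ
    have hsub : ∫ x, f x ∂ρ - f x₀ = ∫ x, (f x - f x₀) ∂ρ := by
      rw [integral_sub hfi (integrable_const _)]; simp
    rw [hsub, ← Real.norm_eq_abs]
    refine (norm_integral_le_of_norm_le_const (C := diam (univ : Set X))
      (Eventually.of_forall fun x => ?_)).trans (by simp)
    rw [← dist_eq_norm]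
    exact (by simpa using hf.dist_le_mul x x₀ : dist (f x) (f x₀) ≤ dist x x₀).trans
      (dist_le_diam_of_mem isCompact_univ.isBounded trivial trivial)
  refine ne_top_of_le_ne_top (ENNReal.ofReal_ne_top (r := 2 * diam (univ : Set X))) ?_
  refine iSup₂_le fun f hf => iSup_le fun _ => ENNReal.ofReal_le_ofReal ?_
  have h₁ := abs_le.1 (key f hf μ)
  have h₂ := abs_le.1 (key f hf ν)
  exact abs_le.2 ⟨by linarith, by linarith⟩

/-- Closed sets form a generating π-system, and their indicators are limits of thickened indicators,
which are Lipschitz. -/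
lemma eq_of_krDist_eq_zero {μ ν : Measure X} [IsProbabilityMeasure μ]
    [IsProbabilityMeasure ν] (h : krDist μ ν = 0) : μ = ν := by
  have hint : ∀ {K : ℝ≥0} {f : X → ℝ}, LipschitzWith K f → ∫ x, f x ∂μ = ∫ x, f x ∂ν :=
    fun {K f} hf => by
      have := hf.ofReal_abs_integral_sub_le μ ν
      rw [h, mul_zero, nonpos_iff_eq_zero, ENNReal.ofReal_eq_zero] at this
      exact sub_eq_zero.1 (abs_eq_zero.1 (this.antisymm (abs_nonneg _)))
  refine ext_of_generate_finite _
    (BorelSpace.measurable_eq.trans borel_eq_generateFrom_isClosed) isPiSystem_isClosed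
    (fun F hF => ?_) (by simp)
  have hpos : ∀ n : ℕ, (0 : ℝ) < 1 / (n + 1) := fun n => Nat.one_div_pos_of_nat
  have hlim := tendsto_one_div_add_atTop_nhds_zero_nat (𝕜 := ℝ)
  refine tendsto_nhds_unique
    (tendsto_lintegral_thickenedIndicator_of_isClosed μ hF hpos hlim) ?_
  refine (tendsto_lintegral_thickenedIndicator_of_isClosed ν hF hpos hlim).congr fun n => ?_
  have hL := lipschitzWith_thickenedIndicator (hpos n) F
  have hc : Continuous fun x => ((thickenedIndicator (hpos n) F x : ℝ≥0) : ℝ) :=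
    NNReal.continuous_coe.comp hL.continuous
  rw [lintegral_coe_eq_integral _ (hc.integrable_of_compactSpace ν),
    lintegral_coe_eq_integral _ (hc.integrable_of_compactSpace μ)]
  exact congrArg _ (hint (LipschitzWith.of_dist_le_mul fun x y => hL.dist_le_mul x y)).symm

end KantorovichRubinstein

section MarkovOperator

variable {X ι : Type*} [MeasurableSpace X]

lemma markovOp_apply {u : ι → X → X} (hu : ∀ i, Measurable (u i)) (α : ι → ℝ≥0)
    (ν : Measure X) {S : Set X} (hS : MeasurableSet S) :
    markovOp u α ν S = ∑' i, (α i : ℝ≥0∞) * ν (u i ⁻¹' S) := by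
  simp only [markovOp, Measure.sum_apply _ hS, Measure.smul_apply, Measure.map_apply (hu _) hS]
  rfl

lemma markovOp_apply_univ {u : ι → X → X} (hu : ∀ i, Measurable (u i)) (α : ι → ℝ≥0)
    (ν : Measure X) [IsProbabilityMeasure ν] :
    markovOp u α ν univ = ∑' i, (α i : ℝ≥0∞) := by
  simp [markovOp_apply hu α ν MeasurableSet.univ]

lemma isProbabilityMeasure_markovOp {u : ι → X → X} (hu : ∀ i, Measurable (u i)) {α : ι → ℝ≥0}
    (hα : ∑' i, (α i : ℝ≥0∞) = 1) (ν : Measure X) [IsProbabilityMeasure ν] :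
    IsProbabilityMeasure (markovOp u α ν) :=
  ⟨by rw [markovOp_apply_univ hu, hα]⟩

variable [MetricSpace X] [CompactSpace X] [BorelSpace X]

lemma hasSum_integral_markovOp {u : ι → X → X} (hu : ∀ i, Continuous (u i)) {α : ι → ℝ≥0}
    (hα : ∑' i, (α i : ℝ≥0∞) ≠ ∞) (ν : Measure X) [IsProbabilityMeasure ν] {f : X → ℝ}
    (hf : Continuous f) :
    HasSum (fun i => α i * ∫ x, f (u i x) ∂ν) (∫ x, f x ∂markovOp u α ν) := by
  have : IsFiniteMeasure (markovOp u α ν) :=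
    ⟨by rw [markovOp_apply_univ fun i => (hu i).measurable]; exact hα.lt_top⟩
  convert! hasSum_integral_measure (hf.integrable_of_compactSpace (markovOp u α ν)) using 2 with i
  rw [integral_smul_nnreal_measure,
    integral_map (hu i).aemeasurable hf.aestronglyMeasurable]
  rfl

lemma krDist_markovOp_le {u : ι → X → X} {s : ℝ≥0} (hu : ∀ i, LipschitzWith s (u i))
    {α : ι → ℝ≥0} (hα : ∑' i, (α i : ℝ≥0∞) ≤ 1) (μ ν : Measure X) [IsProbabilityMeasure μ]
    [IsProbabilityMeasure ν] :
    krDist (markovOp u α μ) (markovOp u α ν) ≤ s * krDist μ ν := by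
  refine iSup₂_le fun f hf => iSup_le fun _ => ?_
  have hα' : ∑' i, (α i : ℝ≥0∞) ≠ ∞ := ne_top_of_le_ne_top ENNReal.one_ne_top hα
  have hsum := (hasSum_integral_markovOp (fun i => (hu i).continuous) hα' μ hf.continuous).sub
    (hasSum_integral_markovOp (fun i => (hu i).continuous) hα' ν hf.continuous)
  rw [← hsum.tsum_eq, ← Real.enorm_eq_ofReal_abs]
  calc ‖∑' i, (α i * ∫ x, f (u i x) ∂μ - α i * ∫ x, f (u i x) ∂ν)‖ₑ
      ≤ ∑' i, ‖α i * ∫ x, f (u i x) ∂μ - α i * ∫ x, f (u i x) ∂ν‖ₑ := enorm_tsum_le_tsum_enorm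
    _ ≤ ∑' i, (α i : ℝ≥0∞) * (s * krDist μ ν) := by
        refine ENNReal.tsum_le_tsum fun i => ?_
        rw [← mul_sub, enorm_mul, Real.enorm_eq_ofReal_abs (_ - _), Real.enorm_of_nonneg (by simp),
          ENNReal.ofReal_coe_nnreal]
        gcongr
        simpa using (hf.comp (hu i)).ofReal_abs_integral_sub_le μ ν
    _ ≤ s * krDist μ ν := by
        rw [ENNReal.tsum_mul_right]
        exact mul_le_of_le_one_left' hα

/-- The series converges uniformly in `μ`, dominated by `α i * C` with `C` a bound for `|f|`. -/
lemma continuous_integral_markovOp {u : ι → X → X} (hu : ∀ i, Continuous (u i)) {α : ι → ℝ≥0}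
    (hα : ∑' i, (α i : ℝ≥0∞) ≠ ∞) {f : X → ℝ} (hf : Continuous f) :
    Continuous fun μ : ProbabilityMeasure X => ∫ x, f x ∂markovOp u α (μ : Measure X) := by
  simp_rw [← fun μ : ProbabilityMeasure X =>
    (hasSum_integral_markovOp hu hα (μ : Measure X) hf).tsum_eq]
  obtain ⟨C, hC⟩ := isCompact_univ.exists_bound_of_continuousOn hf.continuousOn
  have hsum : Summable fun i => (α i : ℝ) * C :=
    (NNReal.summable_coe.2 (ENNReal.tsum_coe_ne_top_iff_summable.1 hα)).mul_right C
  refine continuous_tsum (fun i => continuous_const.mul ?_) hsum fun i μ => ?_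
  · exact ProbabilityMeasure.continuous_integral_continuousMap
      (⟨fun x => f (u i x), hf.comp (hu i)⟩ : C(X, ℝ))
  · rw [norm_mul, Real.norm_of_nonneg (α i).coe_nonneg]
    gcongr
    exact (norm_integral_le_of_norm_le_const (Eventually.of_forall fun x =>
      hC (u i x) trivial)).trans (by simp)

/-- The map `μ ↦ krDist (M μ) μ` attains its minimum on the compact space of probability measures;
as `M` contracts `krDist`, the minimizer is a fixed point of `M`. -/
lemma exists_markovOp_eq_self [Nonempty X] {u : ι → X → X} {s : ℝ≥0} (hs : s < 1)
    (hu : ∀ i, LipschitzWith s (u i)) {α : ι → ℝ≥0} (hα : ∑' i, (α i : ℝ≥0∞) = 1) :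
    ∃ m₀ : ProbabilityMeasure X, markovOp u α (m₀ : Measure X) = (m₀ : Measure X) := by
  have hprob := fun μ : ProbabilityMeasure X =>
    isProbabilityMeasure_markovOp (fun i => (hu i).continuous.measurable) hα (μ : Measure X)
  -- A supremum of continuous functions; semicontinuity suffices for a minimum.
  have hlsc : LowerSemicontinuous fun μ : ProbabilityMeasure X =>
      krDist (markovOp u α (μ : Measure X)) (μ : Measure X) := by
    refine lowerSemicontinuous_biSup fun f hf => lowerSemicontinuous_iSup fun _ => ?_
    refine (ENNReal.continuous_ofReal.comp
      (Continuous.abs (Continuous.sub ?_ ?_))).lowerSemicontinuous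
    · exact continuous_integral_markovOp (fun i => (hu i).continuous) (by simp [hα]) hf.continuous
    · exact ProbabilityMeasure.continuous_integral_continuousMap (⟨f, hf.continuous⟩ : C(X, ℝ))
  have : Nonempty (ProbabilityMeasure X) :=
    ⟨⟨Measure.dirac (Classical.arbitrary X), inferInstance⟩⟩
  obtain ⟨m₀, -, hm₀⟩ := (hlsc.lowerSemicontinuousOn univ).exists_isMinOn univ_nonempty
    isCompact_univ
  refine ⟨m₀, ?_⟩
  have := hprob m₀
  refine eq_of_krDist_eq_zero ?_
  -- Compare the minimizer with its own image `M m₀`.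
  have hle := (isMinOn_iff.1 hm₀ ⟨_, hprob m₀⟩ trivial).trans
    (krDist_markovOp_le hu hα.le (markovOp u α (m₀ : Measure X)) m₀)
  by_contra hne
  have hlt := ENNReal.mul_lt_mul_left hne (krDist_ne_top _ _) (ENNReal.coe_lt_one_iff.2 hs)
  rw [one_mul] at hlt
  exact hle.not_gt hlt

lemma markovOp_fixed_unique {u : ι → X → X} {s : ℝ≥0} (hs : s < 1)
    (hu : ∀ i, LipschitzWith s (u i)) {α : ι → ℝ≥0} (hα : ∑' i, (α i : ℝ≥0∞) ≤ 1)
    {μ ν : Measure X} [IsProbabilityMeasure μ] [IsProbabilityMeasure ν]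
    (hμ : markovOp u α μ = μ) (hν : markovOp u α ν = ν) : μ = ν := by
  refine eq_of_krDist_eq_zero ?_
  have hle := krDist_markovOp_le hu hα μ ν
  rw [hμ, hν] at hle
  by_contra hne
  have hlt := ENNReal.mul_lt_mul_left hne (krDist_ne_top _ _) (ENNReal.coe_lt_one_iff.2 hs)
  rw [one_mul] at hlt
  exact hle.not_gt hlt

/-- Since every `α i` is positive, an `m`-null open set has `m`-null preimages, giving `⊆`.
Conversely the union, closed because `ι` is finite, has full measure. -/
lemma iUnion_image_support_eq_of_markovOp_eq [Finite ι] {u : ι → X → X}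
    (hu : ∀ i, Continuous (u i)) {α : ι → ℝ≥0} (hα : ∀ i, 0 < α i) {m : Measure X}
    (hm : markovOp u α m = m) : ⋃ i, u i '' m.support = m.support := by
  have hmeas := fun i => (hu i).measurable
  have hK : IsClosed (⋃ i, u i '' m.support) :=
    (isCompact_iUnion fun i => Measure.isClosed_support.isCompact.image (hu i)).isClosed
  apply Subset.antisymm
  · refine iUnion_subset fun i => image_subset_iff.2 ?_
    have h0 : m m.supportᶜ = 0 := Measure.measure_compl_support
    rw [← hm, markovOp_apply hmeas, hm, ENNReal.tsum_eq_zero] at h0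
    · have hi := (mul_eq_zero.1 (h0 i)).resolve_left (by simpa using (hα i).ne')
      exact compl_subset_compl.1 (Measure.subset_compl_support_of_isOpen
        (Measure.isOpen_compl_support.preimage (hu i)) hi)
    · exact Measure.isOpen_compl_support.measurableSet
  · refine Measure.support_subset_of_isClosed hK ?_
    -- Only the outer `m` is to be rewritten, not the one inside `m.support`.
    rw [mem_ae_iff, ← congrArg (fun ρ : Measure X => ρ _) hm,
      markovOp_apply hmeas α m hK.isOpen_compl.measurableSet, ENNReal.tsum_eq_zero]
    refine fun i => mul_eq_zero_of_right _ (measure_mono_null ?_ Measure.measure_compl_support)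
    exact fun x hx hxm => hx (mem_iUnion_of_mem i (mem_image_of_mem _ hxm))

end MarkovOperator

section Attractor

variable {X ι : Type*} [MetricSpace X] {u : ι → X → X} {s : ℝ≥0}

/-- The point of `A` farthest from `B` is some `u i a'`, so its distance to `B` is at most `s` times
itself. -/
lemma subset_of_iUnion_image_eq (hs : s < 1) (hu : ∀ i, LipschitzWith s (u i)) {A B : Set X}
    (hA : IsCompact A) (hB : IsCompact B) (hBne : B.Nonempty) (hAu : ⋃ i, u i '' A = A)
    (hBu : ⋃ i, u i '' B = B) : A ⊆ B := by
  rcases A.eq_empty_or_nonempty with rfl | hAne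
  · exact empty_subset _
  obtain ⟨a, ha, hmax⟩ := hA.exists_isMaxOn hAne (continuous_infDist_pt B).continuousOn
  have hcontr : infDist a B ≤ s * infDist a B := by
    obtain ⟨i, a', ha', rfl⟩ := mem_iUnion.1 (hAu.symm ▸ ha)
    obtain ⟨b, hb, hab⟩ := hB.exists_infDist_eq_dist hBne a'
    calc infDist (u i a') B ≤ dist (u i a') (u i b) :=
          infDist_le_dist_of_mem (hBu ▸ mem_iUnion_of_mem i (mem_image_of_mem _ hb))
      _ ≤ s * infDist a' B := hab ▸ (hu i).dist_le_mul a' b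
      _ ≤ s * infDist (u i a') B := by gcongr; exact hmax ha'
  have hs' : (s : ℝ) < 1 := hs
  have h0 : infDist a B ≤ 0 := by nlinarith [infDist_nonneg (x := a) (s := B)]
  intro x hx
  exact (hB.isClosed.mem_iff_infDist_zero hBne).2 (((hmax hx).trans h0).antisymm infDist_nonneg)

end Attractor

theorem mainTheorem12 {X : Type*} [MetricSpace X] [CompactSpace X] [Nonempty X]
    [MeasurableSpace X] [BorelSpace X] {ι : Type*} [Countable ι]
    (u : ι → X → X) (c : ι → ℝ≥0) (s : ℝ≥0) (α : ι → ℝ≥0)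
    (hu : ∀ i, LipschitzWith (c i) (u i)) (hc : ∀ i, c i ≤ s) (hs : s < 1)
    (hα : ∑' i, (α i : ℝ≥0∞) ≤ 1) :
    (∀ μ ν : ProbabilityMeasure X,
      krDist (μ : Measure X) (ν : Measure X) ≠ ∞ ∧
      krDist (markovOp u α (μ : Measure X)) (markovOp u α (ν : Measure X)) ≤
        s * krDist (μ : Measure X) (ν : Measure X)) ∧
    (∑' i, (α i : ℝ≥0∞) = 1 →
      (∀ μ : ProbabilityMeasure X, IsProbabilityMeasure (markovOp u α (μ : Measure X))) ∧
      ∃! m₀ : ProbabilityMeasure X, markovOp u α (m₀ : Measure X) = (m₀ : Measure X)) ∧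
    (Finite ι → (∀ i, 0 < α i) → ∀ m₀ : ProbabilityMeasure X,
      markovOp u α (m₀ : Measure X) = (m₀ : Measure X) →
        IsIFSAttractor u (m₀ : Measure X).support) := by
  have hu' : ∀ i, LipschitzWith s (u i) := fun i => (hu i).weaken (hc i)
  refine ⟨fun μ ν => ⟨krDist_ne_top _ _, krDist_markovOp_le hu' hα _ _⟩, fun hα₁ => ⟨fun μ =>
    isProbabilityMeasure_markovOp (fun i => (hu i).continuous.measurable) hα₁ _, ?_⟩,
    fun _ hpos m₀ hm₀ => ?_⟩
  · obtain ⟨m₀, hm₀⟩ := exists_markovOp_eq_self hs hu' hα₁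
    exact ⟨m₀, hm₀, fun m hm => Subtype.ext
      (markovOp_fixed_unique (μ := (m : Measure X)) (ν := (m₀ : Measure X)) hs hu' hα hm hm₀)⟩
  · have hfix := iUnion_image_support_eq_of_markovOp_eq (fun i => (hu i).continuous) hpos hm₀
    have hcomp := (Measure.isClosed_support (μ := (m₀ : Measure X))).isCompact
    have hne := Measure.nonempty_support (NeZero.ne (m₀ : Measure X))
    exact ⟨hne, hcomp, hfix, fun B hBne hB hBu =>
      (subset_of_iUnion_image_eq hs hu' hB hcomp hne hBu hfix).antisymm
        (subset_of_iUnion_image_eq hs hu' hcomp hB hBne hfix hBu)⟩
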